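/- Let $G$ be a torsion-free abelian group, written additively, and let $S\subseteq G$ be a subsemigroup with $0\in S$ that contains no subgroup of $G$ other than $\{0\}$. Let $\Gamma=S-S$ be the subgroup of $G$ generated by $S$. An isometric representation of $S$ on a complex Hilbert space $H$ is a map $V:S\to B(H)$, $a\mapsto V_a$, such that $V_{a+b}=V_aV_b$ for all $a,b\in S$ and every $V_a$ is an isometry. It is faithful if $a\mapsto V_a$ is injective; irreducible if $H\neq 0$ and the only closed subspaces of $H$ invariant under all $V_a$ and all $V_a^*$ ($a\in S$) are $0$ and $H$; and non-unitary if $V_a$ is not unitary for any $a\in S$, $a\neq 0$. Let $\Delta_S$ be the class of all faithful irreducible non-unitary isometric representations of $S$. For $V\in\Delta_S$ let $C^*(V)\subseteq B(H)$ be the $C^*$-algebra generated by $\{V_a: a\in S\}$, and let $S_V$ be the multiplicative semigroup generated by all the operators $V_a$ and $V_b^*$, $a,b\in S$. Theorem. The following are equivalent: 1. $S$ is a positive cone of $\Gamma$, i.e. $\Gamma=S\cup(-S)$ and $S\cap(-S)=\{0\}$; 2. the $C^*$-algebras generated by the representations in $\Delta_S$ are all canonically isomorphic: for all $V,W\in\Delta_S$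 there is a $*$-isomorphism $\varphi:C^*(V)\to C^*(W)$ with $\varphi(V_a)=W_a$ for all $a\in S$; 3. every $V\in\Delta_S$ is inverse, i.e. $S_V$ is an inverse semigroup: for each $x\in S_V$ there is exactly one $y\in S_V$ with $xyx=x$ and $yxy=y$; 4. for every $V\in\Delta_S$ and all $a,b\in S$, $V_aV_a^*V_bV_b^*=V_bV_b^*V_aV_a^*$. -/

import Mathlib

universe u

noncomputable section

namespace IsomRep

section Cone

variable {G : Type*} [AddCommGroup G]

/-- The group `Γ = S - S` of differences of elements of `S`. -/
def differenceGroup (S : AddSubmonoid G) : AddSubgroup G where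
  carrier := {g | ∃ a ∈ S, ∃ b ∈ S, g = a - b}
  zero_mem' := ⟨0, S.zero_mem, 0, S.zero_mem, by simp⟩
  add_mem' := by
    rintro _ _ ⟨a, ha, b, hb, rfl⟩ ⟨c, hc, d, hd, rfl⟩
    exact ⟨a + c, S.add_mem ha hc, b + d, S.add_mem hb hd, by abel⟩
  neg_mem' := by
    rintro _ ⟨a, ha, b, hb, rfl⟩
    exact ⟨b, hb, a, ha, by abel⟩

/-- `S` is a positive cone of the group `Γ`: `Γ = S ∪ (-S)` and `S ∩ (-S) = {0}`. -/
def IsPositiveConeOf (S : AddSubmonoid G) (Γ : AddSubgroup G) : Prop :=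
  (∀ g : G, g ∈ Γ ↔ g ∈ S ∨ -g ∈ S) ∧ ∀ g : G, (g ∈ S ∧ -g ∈ S) ↔ g = 0

/-- `S` contains no groups (other than the trivial one). -/
def ContainsNoGroups (S : AddSubmonoid G) : Prop :=
  ∀ K : AddSubgroup G, (K : Set G) ⊆ (S : Set G) → K = ⊥

end Cone

/-- An inverse semigroup: every element `x` has exactly one inverse `y`. -/
def IsInverseSemigroup (P : Type*) [Semigroup P] : Prop :=
  ∀ x : P, ∃! y : P, x * y * x = x ∧ y * x * y = y

section Rep

variable {G : Type*} [AddCommGroup G] {S : AddSubmonoid G}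
variable {H : Type*} [NormedAddCommGroup H] [InnerProductSpace ℂ H]

/-- `V` is a representation of the semigroup `S` by isometries of `H`. -/
structure IsIsometricRep (V : S → H →L[ℂ] H) : Prop where
  map_add : ∀ a b : S, V (a + b) = V a * V b
  isometry : ∀ a : S, Isometry (V a)

variable [CompleteSpace H]

/-- `H ≠ 0`, and the only closed subspaces of `H` that reduce all the operators `V a`
(that is, are invariant under all `V a` and all `(V a)*`) are `0` and `H`. -/
def IsIrreducibleRep (V : S → H →L[ℂ] H) : Prop :=
  Nontrivial H ∧ ∀ K : Submodule ℂ H, IsClosed (K : Set H) →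
    (∀ a : S, ∀ x ∈ K, V a x ∈ K ∧ star (V a) x ∈ K) → K = ⊥ ∨ K = ⊤

/-- No `V a` with `a ≠ 0` is a unitary operator. -/
def IsNonunitaryRep (V : S → H →L[ℂ] H) : Prop :=
  ∀ a : S, a ≠ 0 → V a ∉ unitary (H →L[ℂ] H)

/-- `V` is a faithful irreducible non-unitary isometric representation of `S`
(its unitary equivalence class belongs to `Δ_S`). -/
structure IsDeltaRep (V : S → H →L[ℂ] H) : Prop where
  isometric : IsIsometricRep V
  faithful : Function.Injective V
  irreducible : IsIrreducibleRep V
  nonunitary : IsNonunitaryRep V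

/-- The C*-algebra generated by the operators `V a`, `a ∈ S`. It is unital, as is the norm closed
star algebra generated by the `V a` of an isometric representation, where `V 0 = 1`. -/
def cstarAlg (V : S → H →L[ℂ] H) : StarSubalgebra ℂ (H →L[ℂ] H) :=
  (StarAlgebra.adjoin ℂ (Set.range V)).topologicalClosure

/-- The operator `V a` as an element of the C*-algebra generated by `V`. -/
def gen (V : S → H →L[ℂ] H) (a : S) : cstarAlg V :=
  ⟨V a, StarSubalgebra.le_topologicalClosure _
    (StarAlgebra.subset_adjoin ℂ (Set.range V) (Set.mem_range_self a))⟩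

/-- The semigroup `S_V` of monomials: all finite products of operators `V a` and `(V b)*`. -/
def monomials (V : S → H →L[ℂ] H) : Subsemigroup (H →L[ℂ] H) :=
  Subsemigroup.closure (Set.range V ∪ Set.range fun b => star (V b))

/-- The representation `V` is inverse: `S_V` is an inverse semigroup. -/
def IsInverseRep (V : S → H →L[ℂ] H) : Prop :=
  IsInverseSemigroup (monomials V)

/-- The C*-algebras generated by `V` and `W` are canonically isomorphic: there is a
star isomorphism between them that takes `V a` to `W a` for all `a ∈ S`. -/
def CanonicallyIsomorphic {H' : Type*} [NormedAddCommGroup H'] [InnerProductSpace ℂ H']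
    [CompleteSpace H'] (V : S → H →L[ℂ] H) (W : S → H' →L[ℂ] H') : Prop :=
  ∃ φ : cstarAlg V ≃⋆ₐ[ℂ] cstarAlg W, ∀ a : S, φ (gen V a) = gen W a

end Rep

end IsomRep

end

/-!
For a subsemigroup without subgroups the first condition says that `S` is total: of two elements
of `S` one is the sum of the other and an element of `S`.

**Total semigroups.** Every product of operators `V a` and `(V b)*` collapses to a single word
`V a * (V b)*`. Such a word is idempotent only if `a = b`, and the range projections form a chain,
so that `S_V` is an inverse semigroup (`isInverseRep_of_isTotal`).

The C*-algebras are compared through the algebra generated by the pairs `(V a, W a)` in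
`B(H) × B(H')`; it suffices that both coordinate maps are isometric on the span of the words of
pairs. Since `W` is non-unitary, any finite set of operators `(W t)*` with `t ≠ 0` has a common
unit vector in the kernels, and matrix coefficients at translates of such a vector bound each
coefficient of a combination `z = ∑ c p • word W p` by `2 * ‖z‖` (`norm_coeff_le`). Hence the norm
of the same combination of words of pairs is at most `2 * ‖z‖` times the number of its words, up
to the norm of `1`. Because `G` is abelian, the number of words that occur in `(x* x) ^ n` grows
only polynomially in `n` (`exists_pow_mem_span_wordBox`, `card_le_of_subset_wordBox`). Taking
`n`-th roots removes the polynomial factor (`norm_le_norm_map_of_mem_adjoin`).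

**Back to the cone condition.** Idempotents of an inverse semigroup commute, so the third condition
implies the fourth. The regular representation on `ℓ²(S)` belongs to `Δ_S` and has commuting range
projections; a canonical isomorphism carries this over, so the second condition implies the fourth.
Finally, if `d = a - b` is in neither `S` nor `-S`, the translations of `ℓ²(G)` are restricted to
the invariant subspace generated by `e₀ + e_d`. This vector is orthogonal to its translates by the
nonzero elements of `S`, which makes the representation irreducible (`isDeltaRep_of_wandering`).
Because `G` is torsion-free, `2d` and `-2d` are not both in `S`, and after interchanging `a` and `b`
if necessary the range projections of `a` and `b` do not commute (`exists_isDeltaRep_not_comm`).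
-/

noncomputable section

namespace IsomRep

open scoped InnerProductSpace

/-! ### Isometric representations -/

section Basic

variable {G : Type*} [AddCommGroup G] {S : AddSubmonoid G}
variable {H : Type*} [NormedAddCommGroup H] [InnerProductSpace ℂ H]

theorem ContainsNoGroups.eq_zero (hS : ContainsNoGroups S) {g : G} (h₁ : g ∈ S) (h₂ : -g ∈ S) :
    g = 0 := by
  let K : AddSubgroup G :=
    { carrier := {x | x ∈ S ∧ -x ∈ S}
      zero_mem' := by simp
      add_mem' := by
        rintro a b ⟨ha, ha'⟩ ⟨hb, hb'⟩
        exact ⟨S.add_mem ha hb, by rw [neg_add]; exact S.add_mem ha' hb'⟩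
      neg_mem' := by
        rintro a ⟨ha, ha'⟩
        exact ⟨ha', by rwa [neg_neg]⟩ }
  have hK : K = ⊥ := hS K fun x hx => hx.1
  have hg : g ∈ K := ⟨h₁, h₂⟩
  rwa [hK, AddSubgroup.mem_bot] at hg

namespace IsIsometricRep

variable {V : S → H →L[ℂ] H}

theorem map_add_apply (hV : IsIsometricRep V) (a b : S) (x : H) : V (a + b) x = V a (V b x) :=
  congr($(hV.map_add a b) x)

variable [CompleteSpace H]

theorem star_mul_self (hV : IsIsometricRep V) (a : S) : star (V a) * V a = 1 :=
  (ContinuousLinearMap.norm_map_iff_adjoint_comp_self (V a)).1 fun x => by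
    simpa using (hV.isometry a).dist_eq x 0

theorem map_zero (hV : IsIsometricRep V) : V 0 = 1 := by
  have h := hV.map_add 0 0
  rw [add_zero] at h
  calc V 0 = star (V 0) * V 0 * V 0 := by rw [hV.star_mul_self, one_mul]
    _ = 1 := by rw [mul_assoc, ← h, hV.star_mul_self]

theorem star_map_apply_map (hV : IsIsometricRep V) (a : S) (x : H) : star (V a) (V a x) = x :=
  congr($(hV.star_mul_self a) x)

theorem inner_map_map (hV : IsIsometricRep V) (a : S) (x y : H) : ⟪V a x, V a y⟫_ℂ = ⟪x, y⟫_ℂ := by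
  rw [← ContinuousLinearMap.adjoint_inner_right, ← ContinuousLinearMap.star_eq_adjoint,
    hV.star_map_apply_map]

end IsIsometricRep

variable [CompleteSpace H]

theorem inner_star_left (A : H →L[ℂ] H) (x y : H) : ⟪star A x, y⟫_ℂ = ⟪x, A y⟫_ℂ :=
  ContinuousLinearMap.adjoint_inner_left A y x

theorem inner_star_right (A : H →L[ℂ] H) (x y : H) : ⟪x, star A y⟫_ℂ = ⟪A x, y⟫_ℂ :=
  ContinuousLinearMap.adjoint_inner_right A x y

end Basic

/-! ### Representations generated by a wandering vector -/

section Cyclic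

variable {G : Type*} [AddCommGroup G] {S : AddSubmonoid G}
variable {H : Type*} [NormedAddCommGroup H] [InnerProductSpace ℂ H]

theorem eq_of_inner_cyclic {V : S → H →L[ℂ] H} {η : H}
    (hcyc : (Submodule.span ℂ (Set.range fun s => V s η)).topologicalClosure = ⊤) {x y : H}
    (h : ∀ s, ⟪V s η, x⟫_ℂ = ⟪V s η, y⟫_ℂ) : x = y := by
  set K := Submodule.span ℂ (Set.range fun s => V s η)
  have hK : K ≤ (Submodule.span ℂ {x - y})ᗮ := by
    rw [Submodule.span_le]
    rintro _ ⟨s, rfl⟩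
    rw [SetLike.mem_coe, Submodule.mem_orthogonal_singleton_iff_inner_left, inner_sub_right, h s,
      sub_self]
  have hK' := K.topologicalClosure_minimal hK (Submodule.isClosed_orthogonal _)
  rw [hcyc] at hK'
  have hxy := hK' (Submodule.mem_top (x := x - y))
  rw [Submodule.mem_orthogonal_singleton_iff_inner_left, inner_self_eq_zero] at hxy
  exact sub_eq_zero.1 hxy

variable [CompleteSpace H]

/-- An isometric representation that is generated by a wandering vector `η`, one that is
orthogonal to its translates `V s η` with `s ≠ 0`, belongs to `Δ_S` as soon as these translates are
distinct. For irreducibility: the component `k` of `η`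
in a reducing subspace `K` is annihilated by every `(V s)*` with `s ≠ 0`, hence is a multiple of
`η`, so that `η` lies in `K` or in its complement. -/
theorem isDeltaRep_of_wandering (hS : ContainsNoGroups S) {V : S → H →L[ℂ] H}
    (hV : IsIsometricRep V) {η : H} (hη : η ≠ 0)
    (hcyc : (Submodule.span ℂ (Set.range fun s => V s η)).topologicalClosure = ⊤)
    (hwand : ∀ s : S, s ≠ 0 → ⟪V s η, η⟫_ℂ = 0)
    (hinj : Function.Injective fun s => V s η) : IsDeltaRep V := by
  have hadd : ∀ s t : S, s ≠ 0 → s + t ≠ 0 := by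
    intro s t hs hst
    refine hs (Subtype.ext (hS.eq_zero s.2 ?_))
    have : (s : G) + t = 0 := congrArg Subtype.val hst
    rw [neg_eq_of_add_eq_zero_right this]
    exact t.2
  have hker : ∀ s : S, s ≠ 0 → star (V s) η = 0 := by
    intro s hs
    refine eq_of_inner_cyclic hcyc fun t => ?_
    rw [inner_star_right, ← hV.map_add_apply, hwand _ (hadd s t hs), inner_zero_right]
  refine ⟨hV, fun s t hst => hinj congr($hst η), ⟨⟨η, 0, hη⟩, ?_⟩, ?_⟩
  · intro K hK hinv
    have : CompleteSpace K := hK.completeSpace_coe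
    obtain ⟨k, hk, l, hl, hkl⟩ := K.exists_add_mem_mem_orthogonal η
    have hinv' : ∀ s, ∀ x ∈ Kᗮ, V s x ∈ Kᗮ ∧ star (V s) x ∈ Kᗮ := by
      intro s x hx
      refine ⟨fun y hy => ?_, fun y hy => ?_⟩
      · rw [← inner_star_left]; exact hx _ (hinv s y hy).2
      · rw [inner_star_right]; exact hx _ (hinv s y hy).1
    have hk0 : ∀ s : S, s ≠ 0 → star (V s) k = 0 := by
      intro s hs
      have h0 : star (V s) k + star (V s) l = 0 := by rw [← _root_.map_add, ← hkl, hker s hs]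
      have h1 : star (V s) k ∈ Kᗮ := by
        rw [eq_neg_of_add_eq_zero_left h0]
        exact neg_mem (hinv' s l hl).2
      exact inner_self_eq_zero.1 (h1 _ (hinv s k hk).2)
    have hηη : ⟪η, η⟫_ℂ ≠ 0 := inner_self_ne_zero.2 hη
    have hkη : k = (⟪η, k⟫_ℂ / ⟪η, η⟫_ℂ) • η := by
      refine eq_of_inner_cyclic hcyc fun s => ?_
      rw [inner_smul_right]
      rcases eq_or_ne s 0 with rfl | hs
      · rw [hV.map_zero, one_apply_eq_self, div_mul_cancel₀ _ hηη]
      · rw [hwand s hs, mul_zero, ← inner_star_right, hk0 s hs, inner_zero_right]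
    have hgen : ∀ L : Submodule ℂ H, IsClosed (L : Set H) → η ∈ L →
        (∀ s, ∀ x ∈ L, V s x ∈ L) → L = ⊤ := by
      intro L hL hηL hLinv
      rw [eq_top_iff, ← hcyc]
      refine Submodule.topologicalClosure_minimal _ (Submodule.span_le.2 ?_) hL
      rintro _ ⟨s, rfl⟩
      exact hLinv s η hηL
    by_cases hc : ⟪η, k⟫_ℂ / ⟪η, η⟫_ℂ = 0
    · left
      rw [hc, zero_smul] at hkη
      rw [hkη, zero_add] at hkl
      rw [← Submodule.orthogonal_eq_top_iff]
      exact hgen _ K.isClosed_orthogonal (hkl ▸ hl) fun s x hx => (hinv' s x hx).1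
    · right
      refine hgen K hK ?_ fun s x hx => (hinv s x hx).1
      rw [hkη] at hk
      exact (K.smul_mem_iff hc).1 hk
  · intro s hs hu
    have h := congr($(Unitary.mul_star_self_of_mem hu) η)
    rw [mul_apply_eq_comp, hker s hs, _root_.map_zero] at h
    exact hη h.symm

end Cyclic

section Restrict

variable {G : Type*} [AddCommGroup G] {S : AddSubmonoid G}
variable {E : Type*} [NormedAddCommGroup E] [InnerProductSpace ℂ E]

/-- The closed linear span of the orbit of `η` under the operators `U s`. -/
def cyclicSubspace (U : S → E →L[ℂ] E) (η : E) : Submodule ℂ E :=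
  (Submodule.span ℂ (Set.range fun s => U s η)).topologicalClosure

variable {U : S → E →L[ℂ] E}

theorem map_mem_cyclicSubspace (hU : IsIsometricRep U) (η : E) (a : S) {x : E}
    (hx : x ∈ cyclicSubspace U η) : U a x ∈ cyclicSubspace U η := by
  have hle : Submodule.span ℂ (Set.range fun s => U s η) ≤
      (cyclicSubspace U η).comap (U a).toLinearMap := by
    rw [Submodule.span_le]
    rintro _ ⟨s, rfl⟩
    refine Submodule.le_topologicalClosure _ (Submodule.subset_span ⟨a + s, ?_⟩)
    exact congr($(hU.map_add a s) η)
  exact Submodule.topologicalClosure_minimal _ hle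
    ((Submodule.isClosed_topologicalClosure _).preimage (U a).continuous) hx

theorem orbit_mem_cyclicSubspace (U : S → E →L[ℂ] E) (η : E) (s : S) :
    U s η ∈ cyclicSubspace U η :=
  Submodule.le_topologicalClosure _ (Submodule.subset_span ⟨s, rfl⟩)

/-- The restriction of the representation `U` to the cyclic subspace of `η`. -/
def cyclicRep (hU : IsIsometricRep U) (η : E) (a : S) :
    cyclicSubspace U η →L[ℂ] cyclicSubspace U η :=
  ((U a).comp (cyclicSubspace U η).subtypeL).codRestrict _
    fun x => map_mem_cyclicSubspace hU η a x.2

@[simp]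
theorem coe_cyclicRep_apply (hU : IsIsometricRep U) (η : E) (a : S) (x : cyclicSubspace U η) :
    (cyclicRep hU η a x : E) = U a x := rfl

theorem isIsometricRep_cyclicRep (hU : IsIsometricRep U) (η : E) :
    IsIsometricRep (cyclicRep hU η) where
  map_add a b := by
    ext x
    exact congr($(hU.map_add a b) x)
  isometry a := by
    refine Isometry.of_dist_eq fun x y => ?_
    exact (hU.isometry a).dist_eq x y

variable [CompleteSpace E]

instance (U : S → E →L[ℂ] E) (η : E) : CompleteSpace (cyclicSubspace U η) :=
  (Submodule.isClosed_topologicalClosure _).completeSpace_coe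

/-- The vector `η` as an element of its cyclic subspace. -/
def cyclicVector (hU : IsIsometricRep U) (η : E) : cyclicSubspace U η :=
  ⟨η, by simpa [hU.map_zero] using orbit_mem_cyclicSubspace U η 0⟩

@[simp]
theorem coe_cyclicVector (hU : IsIsometricRep U) (η : E) : (cyclicVector hU η : E) = η := rfl

theorem closure_orbit_cyclicVector (hU : IsIsometricRep U) (η : E) :
    (Submodule.span ℂ (Set.range fun s =>
      cyclicRep hU η s (cyclicVector hU η))).topologicalClosure = ⊤ := by
  rw [eq_top_iff]
  rintro ⟨x, hx⟩ -
  have himg : Submodule.map (cyclicSubspace U η).subtype (Submodule.span ℂ (Set.range fun s =>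
      cyclicRep hU η s (cyclicVector hU η))) = Submodule.span ℂ (Set.range fun s => U s η) := by
    rw [Submodule.map_span, ← Set.range_comp]
    rfl
  have hx' : x ∈ closure (((↑) : cyclicSubspace U η → E) '' (Submodule.span ℂ (Set.range fun s =>
      cyclicRep hU η s (cyclicVector hU η)) : Set (cyclicSubspace U η))) := by
    have := congrArg (fun K : Submodule ℂ E => closure (K : Set E)) himg
    simp only [Submodule.map_coe] at this
    exact this ▸ hx
  exact (closure_subtype (x := ⟨x, hx⟩)).2 hx'

theorem isDeltaRep_cyclicRep (hS : ContainsNoGroups S) (hU : IsIsometricRep U) {η : E}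
    (hη : η ≠ 0) (hwand : ∀ s : S, s ≠ 0 → ⟪U s η, η⟫_ℂ = 0)
    (hinj : Function.Injective fun s => U s η) : IsDeltaRep (cyclicRep hU η) :=
  isDeltaRep_of_wandering hS (isIsometricRep_cyclicRep hU η) (η := cyclicVector hU η)
    (fun h => hη congr(($h : E))) (closure_orbit_cyclicVector hU η)
    (fun s hs => hwand s hs) (fun _ _ h => hinj congr(($h : E)))

end Restrict

/-! ### Translations of `ℓ²(G)` -/

section Shift

variable {G : Type*}

/-- The standard basis vector of `ℓ²(G)` at `x`. -/
def basisVec (x : G) : lp (fun _ : G => ℂ) 2 := by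
  classical exact lp.single 2 x 1

open Classical in
theorem inner_basisVec (x y : G) : ⟪basisVec x, basisVec y⟫_ℂ = if x = y then 1 else 0 := by
  rw [basisVec, basisVec, lp.inner_single_left]
  simp [Pi.single_apply]

@[simp]
theorem norm_basisVec (x : G) : ‖basisVec x‖ = 1 := by
  classical
  simp [basisVec, lp.norm_single]

theorem basisVec_ne_zero (x : G) : basisVec x ≠ 0 := fun h => by
  simpa [h] using inner_basisVec x x

theorem basisVec_injective : Function.Injective (basisVec (G := G)) := fun x y h => by
  have := inner_basisVec x y
  rw [h, inner_basisVec y y, if_pos rfl] at this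
  by_contra hxy
  rw [if_neg hxy] at this
  exact one_ne_zero this

theorem ext_basisVec {A B : lp (fun _ : G => ℂ) 2 →L[ℂ] lp (fun _ : G => ℂ) 2}
    (h : ∀ x, A (basisVec x) = B (basisVec x)) : A = B := by
  classical
  refine lp.ext_continuousLinearMap (by simp) fun x => ?_
  exact ContinuousLinearMap.ext_ring (h x)

variable [AddCommGroup G]

theorem orthonormal_basisVec_add (g : G) : Orthonormal ℂ fun x : G => basisVec (g + x) := by
  classical
  rw [orthonormal_iff_ite]
  intro x y
  simp [inner_basisVec]

/-- The translation by `g`, as an isometry of `ℓ²(G)`. -/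
def shift (g : G) : lp (fun _ : G => ℂ) 2 →L[ℂ] lp (fun _ : G => ℂ) 2 :=
  (orthonormal_basisVec_add g).orthogonalFamily.linearIsometry.toContinuousLinearMap

@[simp]
theorem shift_basisVec (g x : G) : shift g (basisVec x) = basisVec (g + x) := by
  classical
  rw [shift, basisVec]
  refine ((orthonormal_basisVec_add g).orthogonalFamily.linearIsometry_apply_single 1).trans ?_
  simp

theorem isIsometricRep_shift (S : AddSubmonoid G) :
    IsIsometricRep fun s : S => shift (s : G) where
  map_add a b := ext_basisVec fun x => by simp [add_assoc]
  isometry a := LinearIsometry.isometry _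

end Shift

/-! ### The regular representation -/

section Regular

variable {G : Type*} [AddCommGroup G] (S : AddSubmonoid G)

/-- The translations of `ℓ²(S)`, the cyclic subspace of the basis vector at `0`. -/
abbrev regularRep (s : S) := cyclicRep (isIsometricRep_shift S) (basisVec (0 : G)) s

variable {S}

theorem isDeltaRep_regularRep (hS : ContainsNoGroups S) : IsDeltaRep (regularRep S) := by
  refine isDeltaRep_cyclicRep hS _ (basisVec_ne_zero 0) (fun s hs => ?_) fun s t h => ?_
  · rw [shift_basisVec, inner_basisVec, if_neg]
    rwa [add_zero, ZeroMemClass.coe_eq_zero]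
  · refine Subtype.ext (basisVec_injective ?_)
    simpa using h

open Classical in
theorem star_regularRep_apply (a s : S) :
    star (regularRep S a) (regularRep S s (cyclicVector (isIsometricRep_shift S) (basisVec 0))) =
      if h : (s - a : G) ∈ S then
        regularRep S ⟨s - a, h⟩ (cyclicVector (isIsometricRep_shift S) (basisVec 0)) else 0 := by
  refine eq_of_inner_cyclic (closure_orbit_cyclicVector (isIsometricRep_shift S) (basisVec 0))
    fun t => ?_
  rw [inner_star_right]
  split_ifs with h
  · simp only [Submodule.coe_inner, coe_cyclicRep_apply, coe_cyclicVector, shift_basisVec,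
      inner_basisVec, add_zero]
    congr 1
    rw [eq_sub_iff_add_eq', eq_iff_iff]
  · simp only [Submodule.coe_inner, coe_cyclicRep_apply, coe_cyclicVector, shift_basisVec,
      inner_basisVec, add_zero, inner_zero_right, ite_eq_right_iff, one_ne_zero]
    intro h'
    rw [← h', add_sub_cancel_left] at h
    exact h t.2

open Classical in
theorem regularRep_mul_star_apply (a s : S) :
    regularRep S a (star (regularRep S a)
      (regularRep S s (cyclicVector (isIsometricRep_shift S) (basisVec 0)))) =
      if (s - a : G) ∈ S then
        regularRep S s (cyclicVector (isIsometricRep_shift S) (basisVec 0)) else 0 := by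
  rw [star_regularRep_apply]
  split_ifs with h
  · rw [← (isIsometricRep_cyclicRep _ _).map_add_apply]
    congr 2
    exact Subtype.ext (add_sub_cancel _ _)
  · rw [_root_.map_zero]

theorem regularRep_comm (a b : S) :
    regularRep S a * star (regularRep S a) * regularRep S b * star (regularRep S b) =
      regularRep S b * star (regularRep S b) * regularRep S a * star (regularRep S a) := by
  classical
  refine ContinuousLinearMap.ext_on ((Submodule.dense_iff_topologicalClosure_eq_top).2
    (closure_orbit_cyclicVector (isIsometricRep_shift S) (basisVec 0))) ?_
  rintro _ ⟨s, rfl⟩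
  simp only [mul_apply_eq_comp, regularRep_mul_star_apply]
  split_ifs <;> simp [regularRep_mul_star_apply, *]

end Regular

/-! ### Semigroups with incomparable elements -/

section Incomparable

variable {G : Type*} [AddCommGroup G] {S : AddSubmonoid G}

/-- If `d = a - b` lies neither in `S` nor in `-S`, and `-2d ∉ S`, then the subrepresentation of
`ℓ²(G)` generated by `η = e₀ + e_d` belongs to `Δ_S`, and the range projections of `a` and `b` do
not commute in it. Indeed `(V a)* (V b) η = η / 2`, so that commuting projections would put
`V a η = e_a + e_{a + d}` into the range of `V b`, all of whose elements take the same value at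
`b` and at `b + d = a`. -/
theorem exists_isDeltaRep_not_comm (hS : ContainsNoGroups S) {a b : S}
    (hab : (a - b : G) ∉ S) (hba : (b - a : G) ∉ S) (h2 : (b - a + (b - a) : G) ∉ S) :
    ∃ η : lp (fun _ : G => ℂ) 2,
      IsDeltaRep (cyclicRep (isIsometricRep_shift S) η) ∧
      cyclicRep (isIsometricRep_shift S) η a * star (cyclicRep (isIsometricRep_shift S) η a) *
          cyclicRep (isIsometricRep_shift S) η b * star (cyclicRep (isIsometricRep_shift S) η b) ≠
        cyclicRep (isIsometricRep_shift S) η b * star (cyclicRep (isIsometricRep_shift S) η b) *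
          cyclicRep (isIsometricRep_shift S) η a *
            star (cyclicRep (isIsometricRep_shift S) η a) := by
  classical
  obtain ⟨d, hd⟩ : ∃ d : G, d = a - b := ⟨_, rfl⟩
  have hbd : (b : G) + d = a := by rw [hd]; abel
  have hdS : ∀ s : S, (s : G) ≠ d := fun s hs => hab (hd ▸ hs ▸ s.2)
  have hdS' : ∀ s : S, (s : G) + d ≠ 0 := fun s hs => hba (by
    rw [← neg_sub, ← hd, ← eq_neg_of_add_eq_zero_left hs]; exact s.2)
  have hdS2 : ∀ s : S, (s : G) + d + d ≠ 0 := fun s hs => h2 (by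
    rw [← neg_sub, ← hd, ← neg_add, ← eq_neg_of_add_eq_zero_left (add_assoc (s : G) d d ▸ hs)]
    exact s.2)
  have hd0 : d ≠ 0 := fun h => hdS 0 h.symm
  have hdd : d + d ≠ 0 := by simpa using hdS2 0
  set η : lp (fun _ : G => ℂ) 2 := basisVec 0 + basisVec d with hη
  set U := isIsometricRep_shift S
  have hshift : ∀ g : G, shift g η = basisVec g + basisVec (g + d) := fun g => by simp [hη]
  have hwand : ∀ s : S, s ≠ 0 → ⟪shift (s : G) η, η⟫_ℂ = 0 := by
    intro s hs
    have hs' : (s : G) ≠ 0 := by simpa using hs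
    simp [hη, inner_basisVec, hs', hdS, hdS']
  have hηη : ⟪η, η⟫_ℂ = 2 := by
    simp only [hη, inner_add_left, inner_add_right, inner_basisVec, hd0, hd0.symm, if_true, if_false]
    norm_num
  have hΔ : IsDeltaRep (cyclicRep U η) := by
    refine isDeltaRep_cyclicRep hS U (fun h => by simp [h] at hηη) hwand fun s t hst => ?_
    -- evaluate `⟪e_s, ·⟫` on both sides
    have h := congrArg (fun v => ⟪basisVec (s : G), v⟫_ℂ) hst
    have h' := congrArg (fun v => ⟪basisVec (t : G), v⟫_ℂ) hst
    by_contra hne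
    have hne' : (s : G) ≠ t := fun h => hne (Subtype.ext h)
    simp only [hshift, inner_add_right, inner_basisVec, left_eq_add, hd0, hne', hne'.symm,
      if_true, if_false, zero_add, add_zero] at h h'
    have h1 : (s : G) = t + d := by by_contra hc; simp [hc] at h
    have h3 : (t : G) = s + d := by by_contra hc; simp [hc] at h'
    rw [h3, add_assoc, left_eq_add] at h1
    exact hdd h1
  refine ⟨η, hΔ, fun hcomm => ?_⟩
  set V := cyclicRep U η
  set ξ := cyclicVector U η
  have hV : IsIsometricRep V := hΔ.isometric
  have hhalf : star (V a) (V b ξ) = (1 / 2 : ℂ) • ξ := by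
    refine eq_of_inner_cyclic (closure_orbit_cyclicVector U η) fun t => ?_
    rw [inner_star_right, ← hV.map_add_apply, inner_smul_right]
    change ⟪shift ((a + t : S) : G) η, shift (b : G) η⟫_ℂ = 1 / 2 * ⟪shift (t : G) η, η⟫_ℂ
    have e1 : ((a + t : S) : G) = b + (t + d) := by
      rw [AddSubmonoid.coe_add, ← hbd]; abel
    rcases eq_or_ne t 0 with rfl | ht
    · rw [add_zero, ZeroMemClass.coe_zero, hshift 0, zero_add, ← hη, hηη, hshift, hshift, hbd,
        ← hbd]
      simp [inner_basisVec, hd0, hdd, add_assoc]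
    · have ht' : (t : G) ≠ 0 := by simpa using ht
      have h3 : (t : G) + (d + d) ≠ 0 := add_assoc (t : G) d d ▸ hdS2 t
      have h4 : (t : G) + (d + d) ≠ d := by simpa [← add_assoc] using hdS' t
      rw [hwand t ht, mul_zero, e1, hshift, hshift]
      simp [inner_basisVec, ht', hdS', h3, h4, add_assoc]
  -- applied to `V b ξ`, commutation of the projections puts `V a ξ` into the range of `V b`
  have hmem : V a ξ = V b (star (V b) (V a ξ)) := by
    have h := congr($hcomm (V b ξ))
    simp only [mul_apply_eq_comp, hV.star_map_apply_map, hhalf, map_smul] at h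
    exact (smul_right_injective _ (by norm_num : (1 / 2 : ℂ) ≠ 0)) h
  have horth : ∀ x ∈ cyclicSubspace (fun s : S => shift (s : G)) η,
      ⟪basisVec d - basisVec 0, x⟫_ℂ = 0 := by
    have hle : cyclicSubspace (fun s : S => shift (s : G)) η ≤
        (Submodule.span ℂ {basisVec d - basisVec 0})ᗮ := by
      refine Submodule.topologicalClosure_minimal _ (Submodule.span_le.2 ?_)
        (Submodule.isClosed_orthogonal _)
      rintro _ ⟨s, rfl⟩
      rw [SetLike.mem_coe, Submodule.mem_orthogonal_singleton_iff_inner_right]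
      simp [hshift, inner_sub_left, inner_add_right, inner_basisVec, (hdS s).symm, (hdS' s).symm]
      simp [eq_comm]
    exact fun x hx => Submodule.mem_orthogonal_singleton_iff_inner_right.1 (hle hx)
  have h0 : ⟪shift (b : G) (basisVec d - basisVec 0), shift (a : G) η⟫_ℂ = 0 := by
    have hmem' : shift (a : G) η = shift (b : G) (star (V b) (V a ξ) : cyclicSubspace _ η) :=
      congr(($hmem : lp (fun _ : G => ℂ) 2))
    rw [hmem', U.inner_map_map b]
    exact horth _ (star (V b) (V a ξ)).2
  rw [map_sub, shift_basisVec, shift_basisVec, add_zero, hbd, hshift, ← hbd] at h0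
  simp [inner_basisVec, hd0, hdd, add_assoc] at h0

end Incomparable

/-! ### Inverse semigroups -/

section Inverse

variable {P : Type*} [Semigroup P]

/-- If the inverse of `x` is `y`, then `f * y * e` is an inverse of `x = e * f` as well. -/
theorem IsInverseSemigroup.isIdempotentElem_mul (hP : IsInverseSemigroup P) {e f : P}
    (he : e * e = e) (hf : f * f = f) : e * f * (e * f) = e * f := by
  obtain ⟨y, ⟨hy₁, hy₂⟩, hyu⟩ := hP (e * f)
  have hy : f * y * e = y := hyu _ ⟨by
      calc e * f * (f * y * e) * (e * f) = e * (f * f) * y * (e * e) * f := by simp only [mul_assoc]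
        _ = e * f * y * (e * f) := by rw [he, hf]; simp only [mul_assoc]
        _ = e * f := hy₁, by
      calc f * y * e * (e * f) * (f * y * e) = f * y * (e * e) * (f * f) * y * e := by
            simp only [mul_assoc]
        _ = f * (y * (e * f) * y) * e := by rw [he, hf]; simp only [mul_assoc]
        _ = f * y * e := by rw [hy₂]⟩
  have hyy : y * y = y := by
    calc y * y = f * y * e * (f * y * e) := by rw [hy]
      _ = f * (y * (e * f) * y) * e := by simp only [mul_assoc]
      _ = y := by rw [hy₂, hy]
  -- the idempotent `y` has the inverses `y` and `e * f`
  have hef : e * f = y :=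
    (hP y).unique ⟨hy₂, hy₁⟩ ⟨by rw [hyy, hyy], by rw [hyy, hyy]⟩
  rw [hef, hyy]

theorem IsInverseSemigroup.mul_comm_of_idempotent (hP : IsInverseSemigroup P) {e f : P}
    (he : e * e = e) (hf : f * f = f) : e * f = f * e := by
  have hef := hP.isIdempotentElem_mul he hf
  have hfe := hP.isIdempotentElem_mul hf he
  refine (hP (e * f)).unique ⟨by rw [hef, hef], by rw [hef, hef]⟩ ⟨?_, ?_⟩
  · calc e * f * (f * e) * (e * f) = e * (f * f) * (e * e) * f := by simp only [mul_assoc]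
      _ = e * f * (e * f) := by rw [he, hf]; simp only [mul_assoc]
      _ = e * f := hef
  · calc f * e * (e * f) * (f * e) = f * (e * e) * (f * f) * e := by simp only [mul_assoc]
      _ = f * e * (f * e) := by rw [he, hf]; simp only [mul_assoc]
      _ = f * e := hfe

theorem inverse_unique_of_idempotents_commute
    (hcomm : ∀ e f : P, e * e = e → f * f = f → e * f = f * e) {x y z : P}
    (hy₁ : x * y * x = x) (hy₂ : y * x * y = y) (hz₁ : x * z * x = x) (hz₂ : z * x * z = z) :
    y = z := by
  have h₁ : x * y * (x * y) = x * y := by rw [← mul_assoc, hy₁]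
  have h₂ : x * z * (x * z) = x * z := by rw [← mul_assoc, hz₁]
  have h₃ : y * x * (y * x) = y * x := by rw [← mul_assoc, hy₂]
  have h₄ : z * x * (z * x) = z * x := by rw [← mul_assoc, hz₂]
  calc y = y * (x * z * x) * y := by rw [hz₁, hy₂]
    _ = y * ((x * z) * (x * y)) := by simp only [mul_assoc]
    _ = y * ((x * y) * (x * z)) := by rw [hcomm _ _ h₂ h₁]
    _ = (y * x * y) * (x * z) := by simp only [mul_assoc]
    _ = y * x * (z * x * z) := by rw [hy₂, hz₂, mul_assoc]
    _ = (y * x) * (z * x) * z := by simp only [mul_assoc]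
    _ = (z * x) * (y * x) * z := by rw [hcomm _ _ h₃ h₄]
    _ = z * (x * y * x) * z := by simp only [mul_assoc]
    _ = z := by rw [hy₁, hz₂]

end Inverse

/-! ### Words in the totally ordered case -/

section Words

variable {G : Type*} [AddCommGroup G] {S : AddSubmonoid G}
variable {A : Type*} [Monoid A] [StarMul A]

/-- The word `T a * (T b)*` of the pair `(a, b)`. -/
def word (T : S → A) (p : S × S) : A := T p.1 * star (T p.2)

theorem star_word (T : S → A) (p : S × S) : star (word T p) = word T p.swap := by
  simp [word]

/-- `S` is total in `G`: of any two of its elements one is the sum of the other and an element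
of `S`. -/
def IsTotal (S : AddSubmonoid G) : Prop :=
  ∀ a b : S, (a - b : G) ∈ S ∨ (b - a : G) ∈ S

variable {T : S → A}

theorem map_zero_eq_one (hadd : ∀ a b, T (a + b) = T a * T b)
    (hiso : ∀ a, star (T a) * T a = 1) : T 0 = 1 := by
  have h := hadd 0 0
  rw [add_zero] at h
  calc T 0 = star (T 0) * T 0 * T 0 := by rw [hiso, one_mul]
    _ = 1 := by rw [mul_assoc, ← h, hiso]

theorem exists_word_mul (hS : IsTotal S) (hadd : ∀ a b, T (a + b) = T a * T b)
    (hiso : ∀ a, star (T a) * T a = 1) (p q : S × S) :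
    ∃ r, word T p * word T q = word T r ∧
      ((r.1 : G) = p.1 - p.2 + q.1 ∧ r.2 = q.2 ∨
        r.1 = p.1 ∧ (r.2 : G) = p.2 + (q.2 - q.1)) := by
  rcases hS q.1 p.2 with h | h
  · obtain ⟨c, hc⟩ : ∃ c : S, q.1 = p.2 + c := ⟨⟨_, h⟩, Subtype.ext (add_sub_cancel _ _).symm⟩
    refine ⟨(p.1 + c, q.2), ?_, Or.inl ⟨?_, rfl⟩⟩
    · calc word T p * word T q = T p.1 * (star (T p.2) * T p.2) * T c * star (T q.2) := by
            rw [word, word, hc, hadd]; simp only [mul_assoc]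
        _ = word T (p.1 + c, q.2) := by rw [hiso, mul_one, word, hadd]
    · rw [hc, AddSubmonoid.coe_add, AddSubmonoid.coe_add]; abel
  · obtain ⟨c, hc⟩ : ∃ c : S, p.2 = q.1 + c := ⟨⟨_, h⟩, Subtype.ext (add_sub_cancel _ _).symm⟩
    refine ⟨(p.1, q.2 + c), ?_, Or.inr ⟨rfl, ?_⟩⟩
    · calc word T p * word T q
          = T p.1 * star (T c) * (star (T q.1) * T q.1) * star (T q.2) := by
            rw [word, word, hc, hadd, star_mul]; simp only [mul_assoc]
        _ = word T (p.1, q.2 + c) := by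
            rw [hiso, mul_one, word, hadd, star_mul, mul_assoc]
    · rw [hc, AddSubmonoid.coe_add, AddSubmonoid.coe_add]; abel

theorem word_mul_swap_mul (hiso : ∀ a, star (T a) * T a = 1) (p : S × S) :
    word T p * word T p.swap * word T p = word T p := by
  calc word T p * word T p.swap * word T p
      = T p.1 * (star (T p.2) * T p.2) * (star (T p.1) * T p.1) * star (T p.2) := by
        simp only [word, Prod.fst_swap, Prod.snd_swap, mul_assoc]
    _ = word T p := by rw [hiso, hiso, mul_one, mul_one, word]

theorem range_proj_comm (hS : IsTotal S) (hadd : ∀ a b, T (a + b) = T a * T b)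
    (hiso : ∀ a, star (T a) * T a = 1) (a b : S) :
    T a * star (T a) * T b * star (T b) = T b * star (T b) * T a * star (T a) := by
  have key : ∀ a c : S, T a * star (T a) * T (a + c) * star (T (a + c)) =
      T (a + c) * star (T (a + c)) * T a * star (T a) := by
    intro a c
    calc T a * star (T a) * T (a + c) * star (T (a + c))
        = T a * (star (T a) * T a) * T c * star (T (a + c)) := by
          rw [hadd]; simp only [mul_assoc]
      _ = T (a + c) * star (T c) * (star (T a) * T a) * star (T a) := by
          rw [hiso, hadd, star_mul]; simp only [mul_assoc, mul_one]
      _ = T (a + c) * star (T (a + c)) * T a * star (T a) := by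
          rw [hadd a c, star_mul]; simp only [mul_assoc]
  rcases hS b a with h | h
  · have hb : b = a + ⟨_, h⟩ := Subtype.ext (add_sub_cancel _ _).symm
    rw [hb]; exact key _ _
  · have ha : a = b + ⟨_, h⟩ := Subtype.ext (add_sub_cancel _ _).symm
    rw [ha]; exact (key _ _).symm

/-- `T a * (T b)*` is idempotent only if `(T b)* * T a = 1`, and this forces `T c = 1` for the
difference `c` of `a` and `b`. -/
theorem eq_of_word_idempotent (hS : IsTotal S) (hadd : ∀ a b, T (a + b) = T a * T b)
    (hiso : ∀ a, star (T a) * T a = 1) (hT : ∀ a, T a = 1 → a = 0) {p : S × S}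
    (hp : word T p * word T p = word T p) : p.1 = p.2 := by
  have h1 : star (T p.2) * T p.1 = 1 := by
    calc star (T p.2) * T p.1
        = (star (T p.1) * T p.1) * star (T p.2) * T p.1 * (star (T p.2) * T p.2) := by
          rw [hiso, hiso, one_mul, mul_one]
      _ = star (T p.1) * (word T p * word T p) * T p.2 := by
          simp only [word, mul_assoc]
      _ = (star (T p.1) * T p.1) * (star (T p.2) * T p.2) := by
          rw [hp, word]; simp only [mul_assoc]
      _ = 1 := by rw [hiso, hiso, mul_one]
  rcases hS p.1 p.2 with h | h
  · obtain ⟨c, hc⟩ : ∃ c : S, p.1 = p.2 + c := ⟨⟨_, h⟩, Subtype.ext (add_sub_cancel _ _).symm⟩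
    rw [hc, hadd, ← mul_assoc, hiso, one_mul] at h1
    rw [hc, hT c h1, add_zero]
  · obtain ⟨c, hc⟩ : ∃ c : S, p.2 = p.1 + c := ⟨⟨_, h⟩, Subtype.ext (add_sub_cancel _ _).symm⟩
    rw [hc, hadd, star_mul, mul_assoc, hiso, mul_one] at h1
    rw [hc, hT c (by rw [← star_star (T c), h1, star_one]), add_zero]

end Words

section Monomials

variable {G : Type*} [AddCommGroup G] {S : AddSubmonoid G}
variable {H : Type*} [NormedAddCommGroup H] [InnerProductSpace ℂ H] [CompleteSpace H]
variable {V : S → H →L[ℂ] H}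

theorem map_mem_monomials (V : S → H →L[ℂ] H) (a : S) : V a ∈ monomials V :=
  Subsemigroup.subset_closure (Or.inl ⟨a, rfl⟩)

theorem star_map_mem_monomials (V : S → H →L[ℂ] H) (a : S) : star (V a) ∈ monomials V :=
  Subsemigroup.subset_closure (Or.inr ⟨a, rfl⟩)

theorem word_mem_monomials (V : S → H →L[ℂ] H) (p : S × S) : word V p ∈ monomials V :=
  mul_mem (map_mem_monomials V p.1) (star_map_mem_monomials V p.2)

theorem exists_eq_word_of_mem_monomials (hS : IsTotal S) (hV : IsIsometricRep V)
    {x : H →L[ℂ] H} (hx : x ∈ monomials V) : ∃ p, x = word V p := by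
  induction hx using Subsemigroup.closure_induction with
  | mem x hx =>
    rcases hx with ⟨a, rfl⟩ | ⟨a, rfl⟩
    · exact ⟨(a, 0), by simp [word, hV.map_zero]⟩
    · exact ⟨(0, a), by simp [word, hV.map_zero]⟩
  | mul x y _ _ hx hy =>
    obtain ⟨p, rfl⟩ := hx
    obtain ⟨q, rfl⟩ := hy
    obtain ⟨r, hr, -⟩ := exists_word_mul hS hV.map_add hV.star_mul_self p q
    exact ⟨r, hr⟩

/-- In the totally ordered case every element of `S_V` is a word `V a * (V b)*`, and the
idempotents are the range projections, which commute. -/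
theorem isInverseRep_of_isTotal (hS : IsTotal S) (hV : IsDeltaRep V) : IsInverseRep V := by
  have hiso := hV.isometric.star_mul_self
  have hone : ∀ a, V a = 1 → a = 0 := fun a ha =>
    hV.faithful (ha.trans hV.isometric.map_zero.symm)
  have hidem : ∀ e : monomials V, e * e = e → ∃ a, (e : H →L[ℂ] H) = V a * star (V a) := by
    rintro ⟨e, he⟩ hee
    obtain ⟨p, rfl⟩ := exists_eq_word_of_mem_monomials hS hV.isometric he
    have hp := eq_of_word_idempotent hS hV.isometric.map_add hiso hone
      (congrArg Subtype.val hee : word V p * word V p = word V p)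
    exact ⟨p.1, by change V p.1 * star (V p.2) = _; rw [← hp]⟩
  have hcomm : ∀ e f : monomials V, e * e = e → f * f = f → e * f = f * e := by
    intro e f he hf
    obtain ⟨a, ha⟩ := hidem e he
    obtain ⟨b, hb⟩ := hidem f hf
    refine Subtype.ext ?_
    change (e : H →L[ℂ] H) * f = f * e
    rw [ha, hb]
    simpa only [mul_assoc] using range_proj_comm hS hV.isometric.map_add hiso a b
  rintro ⟨x, hx⟩
  obtain ⟨p, rfl⟩ := exists_eq_word_of_mem_monomials hS hV.isometric hx
  have h₁ := word_mul_swap_mul hiso p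
  have h₂ := word_mul_swap_mul hiso p.swap
  rw [Prod.swap_swap] at h₂
  refine ⟨⟨word V p.swap, word_mem_monomials V _⟩, ⟨Subtype.ext h₁, Subtype.ext h₂⟩, ?_⟩
  rintro y ⟨hy₁, hy₂⟩
  exact inverse_unique_of_idempotents_commute hcomm hy₁ hy₂ (Subtype.ext h₁) (Subtype.ext h₂)

theorem IsInverseRep.range_proj_comm (hV : IsIsometricRep V) (hinv : IsInverseRep V) (a b : S) :
    V a * star (V a) * V b * star (V b) = V b * star (V b) * V a * star (V a) := by
  have hidem : ∀ a : S, (⟨V a * star (V a), word_mem_monomials V (a, a)⟩ : monomials V) *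
      ⟨V a * star (V a), word_mem_monomials V (a, a)⟩ =
      ⟨V a * star (V a), word_mem_monomials V (a, a)⟩ := by
    intro a
    refine Subtype.ext ?_
    calc V a * star (V a) * (V a * star (V a)) = V a * (star (V a) * V a) * star (V a) := by
          simp only [mul_assoc]
      _ = V a * star (V a) := by rw [hV.star_mul_self, mul_one]
  have h : V a * star (V a) * (V b * star (V b)) = V b * star (V b) * (V a * star (V a)) :=
    congrArg Subtype.val (hinv.mul_comm_of_idempotent (hidem a) (hidem b))
  simpa only [← mul_assoc] using h

end Monomials

/-! ### Coefficients of combinations of words -/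

section Coefficients

theorem exists_forall_rel_of_total {ι : Type*} {r : ι → ι → Prop} (htot : ∀ i j, r i j ∨ r j i)
    (htrans : ∀ i j k, r i j → r j k → r i k) {s : Finset ι} (hs : s.Nonempty) :
    ∃ m ∈ s, ∀ i ∈ s, r i m := by
  induction hs using Finset.Nonempty.cons_induction with
  | singleton a => exact ⟨a, by simp, by simpa using (htot a a).elim id id⟩
  | cons a s ha _ ih =>
    obtain ⟨m, hm, hmax⟩ := ih
    rcases htot a m with h | h
    · exact ⟨m, by simp [hm], by simpa using ⟨h, hmax⟩⟩
    · exact ⟨a, by simp, by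
        simpa using ⟨(htot a a).elim id id, fun i hi => htrans _ _ _ (hmax i hi) h⟩⟩

variable {G : Type*} [AddCommGroup G] {S : AddSubmonoid G}
variable {H : Type*} [NormedAddCommGroup H] [InnerProductSpace ℂ H] [CompleteSpace H]
variable {W : S → H →L[ℂ] H}

theorem exists_star_apply_eq_zero (hW : IsIsometricRep W) {a : S}
    (ha : W a ∉ unitary (H →L[ℂ] H)) : ∃ h, ‖h‖ = 1 ∧ star (W a) h = 0 := by
  by_contra! hne
  refine ha ⟨hW.star_mul_self a, ContinuousLinearMap.ext fun x => ?_⟩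
  have hker : ∀ y, star (W a) y = 0 → y = 0 := by
    intro y hy
    by_contra hy0
    exact hne ((‖y‖⁻¹ : ℂ) • y) (norm_smul_inv_norm hy0) (by rw [map_smul, hy, smul_zero])
  refine sub_eq_zero.1 (hker _ ?_)
  rw [map_sub, mul_apply_eq_comp, hW.star_map_apply_map, one_apply_eq_self, sub_self]

/-- Finitely many of the operators `(W t)*`, `t ≠ 0`, have a common unit vector in their kernels:
the least `t` has one, and it serves for the others. -/
theorem exists_common_kernel (hS : IsTotal S) (hW : IsDeltaRep W) (D : Finset G) :
    ∃ h, ‖h‖ = 1 ∧ ∀ t : S, t ≠ 0 → (t : G) ∈ D → star (W t) h = 0 := by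
  classical
  set D' : Finset S := (D.preimage (fun t : S => (t : G)) Subtype.val_injective.injOn).filter
    fun t => t ≠ 0 with hD'
  have hmem : ∀ t : S, t ≠ 0 → (t : G) ∈ D → t ∈ D' := fun t ht htD => by
    simp [hD', ht, htD]
  rcases D'.eq_empty_or_nonempty with hempty | hne
  · have := hW.irreducible.1
    obtain ⟨h, hh⟩ := exists_norm_eq H zero_le_one
    exact ⟨h, hh, fun t ht htD => by simpa [hempty] using hmem t ht htD⟩
  · obtain ⟨m, hm, hmin⟩ := exists_forall_rel_of_total (r := fun i j : S => (i - j : G) ∈ S)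
      (fun i j => hS i j) (fun i j k h₁ h₂ => by simpa using S.add_mem h₁ h₂) hne
    obtain ⟨h, hh, hker⟩ := exists_star_apply_eq_zero hW.isometric
      (hW.nonunitary m (by simp only [hD', Finset.mem_filter] at hm; exact hm.2))
    refine ⟨h, hh, fun t ht htD => ?_⟩
    have e : t = m + ⟨_, hmin t (hmem t ht htD)⟩ := Subtype.ext (add_sub_cancel _ _).symm
    rw [e, hW.isometric.map_add, star_mul, mul_apply_eq_comp, hker, map_zero]

open Classical in
theorem inner_map_map_of_kernel (hS : IsTotal S) (hW : IsIsometricRep W) {h : H} (hh : ‖h‖ = 1)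
    {x y : S} (hxy : ∀ t : S, t ≠ 0 → (t : G) = x - y ∨ (t : G) = y - x → star (W t) h = 0) :
    ⟪W x h, W y h⟫_ℂ = if x = y then 1 else 0 := by
  split_ifs with he
  · rw [he, hW.inner_map_map, inner_self_eq_norm_sq_to_K, hh]; simp
  rcases hS x y with hd | hd
  · obtain ⟨c, hc⟩ : ∃ c : S, x = y + c := ⟨⟨_, hd⟩, Subtype.ext (add_sub_cancel _ _).symm⟩
    have hc0 : c ≠ 0 := fun h0 => he (by rw [hc, h0, add_zero])
    rw [hc, hW.map_add_apply, hW.inner_map_map, ← inner_star_right,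
      hxy c hc0 (Or.inl (by rw [hc, AddSubmonoid.coe_add]; abel)), inner_zero_right]
  · obtain ⟨c, hc⟩ : ∃ c : S, y = x + c := ⟨⟨_, hd⟩, Subtype.ext (add_sub_cancel _ _).symm⟩
    have hc0 : c ≠ 0 := fun h0 => he (by rw [hc, h0, add_zero])
    rw [hc, hW.map_add_apply, hW.inner_map_map, ← inner_star_left,
      hxy c hc0 (Or.inr (by rw [hc, AddSubmonoid.coe_add]; abel)), inner_zero_left]

open Classical in
/-- A vector `h` in the kernels of the relevant `(W t)*` behaves like the vacuum vector of the
regular representation. -/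
theorem inner_word_of_kernel (hS : IsTotal S) (hW : IsIsometricRep W)
    {h : H} (hh : ‖h‖ = 1) {p q : S × S}
    (h₁ : ∀ t : S, t ≠ 0 → (t : G) = p.2 - q.2 → star (W t) h = 0)
    (h₂ : ∀ t : S, t ≠ 0 → (t : G) = (q.1 - q.2) - (p.1 - p.2) ∨
      (t : G) = (p.1 - p.2) - (q.1 - q.2) → star (W t) h = 0) :
    ⟪W q.1 h, word W p (W q.2 h)⟫_ℂ =
      if (q.2 - p.2 : G) ∈ S ∧ (q.1 - q.2 : G) = p.1 - p.2 then 1 else 0 := by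
  by_cases hd : (q.2 - p.2 : G) ∈ S
  · obtain ⟨c, hc⟩ : ∃ c : S, q.2 = p.2 + c := ⟨⟨_, hd⟩, Subtype.ext (add_sub_cancel _ _).symm⟩
    have e : word W p (W q.2 h) = W (p.1 + c) h := by
      rw [word, mul_apply_eq_comp, hc, hW.map_add_apply, hW.star_map_apply_map, hW.map_add_apply]
    have hcG : (c : G) = q.2 - p.2 := by rw [hc, AddSubmonoid.coe_add]; abel
    rw [e, inner_map_map_of_kernel hS hW hh fun t ht ht' => h₂ t ht (ht'.imp
      (fun h => by rw [h, AddSubmonoid.coe_add, hcG]; abel)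
      (fun h => by rw [h, AddSubmonoid.coe_add, hcG]; abel))]
    congr 1
    rw [eq_iff_iff, Subtype.ext_iff, AddSubmonoid.coe_add, hcG, and_iff_right hd,
      sub_eq_iff_eq_add]
    constructor
    · intro h; rw [h]; abel
    · intro h; rw [h]; abel
  · rw [if_neg fun h => hd h.1]
    obtain hd' := (hS q.2 p.2).resolve_left hd
    obtain ⟨c, hc⟩ : ∃ c : S, p.2 = q.2 + c := ⟨⟨_, hd'⟩, Subtype.ext (add_sub_cancel _ _).symm⟩
    have hc0 : c ≠ 0 := fun h0 => hd (by rw [hc, h0, add_zero, sub_self]; exact S.zero_mem)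
    rw [word, mul_apply_eq_comp, hc, hW.map_add, star_mul, mul_apply_eq_comp,
      hW.star_map_apply_map, h₁ c hc0 (by rw [hc, AddSubmonoid.coe_add]; abel), map_zero,
      inner_zero_right]

/-- The coefficients of a combination of words are controlled by its norm. The matrix
coefficients at the vectors `W q.1 h` and `W q.2 h` are the sums of the `c p` over the words `p`
of the same degree `p.1 - p.2` as `q` with `q.2 - p.2 ∈ S`, and each `c q` is a difference of at most two such
sums. -/
theorem norm_coeff_le (hS : IsTotal S) (hS' : ContainsNoGroups S) (hW : IsDeltaRep W)
    (F : Finset (S × S)) (c : S × S → ℂ) {q : S × S} (hq : q ∈ F) :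
    ‖c q‖ ≤ 2 * ‖∑ p ∈ F, c p • word W p‖ := by
  classical
  set z := ∑ p ∈ F, c p • word W p
  -- the elements `t` for which `(W t)*` occurs in the matrix coefficients of the words in `F`
  set D : Finset G := (F ×ˢ F).image (fun pq => (pq.1.2 - pq.2.2 : G)) ∪
    (F ×ˢ F).image (fun pq => ((pq.1.1 - pq.1.2) - (pq.2.1 - pq.2.2) : G)) with hD
  obtain ⟨h, hh, hker⟩ := exists_common_kernel hS hW D
  have hsum : ∀ q ∈ F, ⟪W q.1 h, z (W q.2 h)⟫_ℂ =
      ∑ p ∈ F with ((q.2 - p.2 : G) ∈ S ∧ (q.1 - q.2 : G) = p.1 - p.2), c p := by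
    intro q hq
    rw [sum_apply, inner_sum, Finset.sum_filter]
    refine Finset.sum_congr rfl fun p hp => ?_
    rw [smul_apply, inner_smul_right,
      inner_word_of_kernel hS hW.isometric hh, mul_ite, mul_one, mul_zero]
    · intro t ht ht'
      refine hker t ht (Finset.mem_union_left _ (Finset.mem_image.2 ⟨(p, q), ?_, ht'.symm⟩))
      exact Finset.mk_mem_product hp hq
    · rintro t ht (ht' | ht')
      · refine hker t ht (Finset.mem_union_right _ (Finset.mem_image.2 ⟨(q, p), ?_, ht'.symm⟩))
        exact Finset.mk_mem_product hq hp
      · refine hker t ht (Finset.mem_union_right _ (Finset.mem_image.2 ⟨(p, q), ?_, ht'.symm⟩))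
        exact Finset.mk_mem_product hp hq
  have hnorm : ∀ a, ‖W a h‖ = 1 := fun a => by
    rw [← hh]; simpa using (hW.isometric.isometry a).dist_eq h 0
  have hbound : ∀ q ∈ F,
      ‖∑ p ∈ F with ((q.2 - p.2 : G) ∈ S ∧ (q.1 - q.2 : G) = p.1 - p.2), c p‖ ≤ ‖z‖ := by
    intro q hq
    rw [← hsum q hq]
    calc ‖⟪W q.1 h, z (W q.2 h)⟫_ℂ‖ ≤ ‖W q.1 h‖ * ‖z (W q.2 h)‖ := norm_inner_le_norm _ _
      _ ≤ ‖z‖ := by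
        rw [hnorm, one_mul]
        simpa [hnorm] using z.le_opNorm (W q.2 h)
  set F₁ := F.filter fun p => (q.2 - p.2 : G) ∈ S ∧ (q.1 - q.2 : G) = p.1 - p.2
  have hqF₁ : q ∈ F₁ := Finset.mem_filter.2 ⟨hq, by rw [sub_self]; exact S.zero_mem, rfl⟩
  have hsplit : c q = ∑ p ∈ F₁, c p - ∑ p ∈ F₁.erase q, c p := by
    rw [← Finset.add_sum_erase _ _ hqF₁, add_sub_cancel_right]
  have herase : ‖∑ p ∈ F₁.erase q, c p‖ ≤ ‖z‖ := by
    rcases (F₁.erase q).eq_empty_or_nonempty with hempty | hne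
    · rw [hempty, Finset.sum_empty, norm_zero]; exact norm_nonneg _
    -- the remaining sum is the matrix coefficient of the next smaller word `m` of the same degree
    · obtain ⟨m, hm, hmax⟩ := exists_forall_rel_of_total
        (r := fun i j : S × S => (j.2 - i.2 : G) ∈ S)
        (fun i j => hS j.2 i.2) (fun i j k h₁ h₂ => by simpa using S.add_mem h₂ h₁) hne
      obtain ⟨hmq, hmF, hm1, hm2⟩ : m ≠ q ∧ m ∈ F ∧ (q.2 - m.2 : G) ∈ S ∧
        (q.1 - q.2 : G) = m.1 - m.2 := by simpa [F₁] using hm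
      convert hbound m hmF using 3
      ext p
      rw [Finset.mem_filter]
      constructor
      · intro hp
        obtain ⟨hpq, hpF, hp1, hp2⟩ : p ≠ q ∧ p ∈ F ∧ (q.2 - p.2 : G) ∈ S ∧
          (q.1 - q.2 : G) = p.1 - p.2 := by simpa [F₁] using hp
        exact ⟨hpF, hmax p hp, hm2.symm.trans hp2⟩
      · rintro ⟨hpF, hp1, hp2⟩
        refine Finset.mem_erase.2 ⟨?_, Finset.mem_filter.2 ⟨hpF, ?_, hm2.trans hp2⟩⟩
        · rintro rfl
          have h0 := hS'.eq_zero hp1 (by rwa [neg_sub])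
          have h2 : (m.2 : G) = p.2 := sub_eq_zero.1 h0
          rw [h2, sub_left_inj] at hp2
          exact hmq (Prod.ext (Subtype.ext hp2) (Subtype.ext h2))
        · simpa using S.add_mem hm1 hp1
  calc ‖c q‖ ≤ ‖∑ p ∈ F₁, c p‖ + ‖∑ p ∈ F₁.erase q, c p‖ := by rw [hsplit]; exact norm_sub_le _ _
    _ ≤ ‖z‖ + ‖z‖ := add_le_add (hbound q hq) herase
    _ = 2 * ‖z‖ := (two_mul _).symm

end Coefficients

/-! ### Polynomial growth -/

section Growth

variable {G : Type*} [AddCommGroup G]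

open Classical in
/-- The combinations of the elements of `B` with coefficients in `{0, …, n}`. -/
def box (B : Finset G) (n : ℕ) : Finset G :=
  (Fintype.piFinset fun _ : B => Finset.range (n + 1)).image fun f => ∑ b : B, f b • (b : G)

theorem mem_box {B : Finset G} {n : ℕ} {g : G} :
    g ∈ box B n ↔ ∃ f : B → ℕ, (∀ b, f b ≤ n) ∧ ∑ b : B, f b • (b : G) = g := by
  simp [box]

theorem card_box_le (B : Finset G) (n : ℕ) : (box B n).card ≤ (n + 1) ^ B.card := by
  classical
  rw [box]
  exact Finset.card_image_le.trans (by simp)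

theorem zero_mem_box (B : Finset G) (n : ℕ) : (0 : G) ∈ box B n :=
  mem_box.2 ⟨0, by simp, by simp⟩

theorem box_mono (B : Finset G) : Monotone (box B) := fun _ _ hmn _ hg => by
  obtain ⟨f, hf, rfl⟩ := mem_box.1 hg
  exact mem_box.2 ⟨f, fun b => (hf b).trans hmn, rfl⟩

theorem add_mem_box_succ {B : Finset G} {n : ℕ} {b g : G} (hb : b ∈ B) (hg : g ∈ box B n) :
    b + g ∈ box B (n + 1) := by
  classical
  obtain ⟨f, hf, rfl⟩ := mem_box.1 hg
  refine mem_box.2 ⟨Pi.single ⟨b, hb⟩ 1 + f, fun x => ?_, ?_⟩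
  · have : (Pi.single ⟨b, hb⟩ 1 : B → ℕ) x ≤ 1 := by
      rw [Pi.single_apply]; split_ifs <;> simp
    rw [Pi.add_apply, add_comm n]
    exact add_le_add this (hf x)
  · simp [add_smul, Finset.sum_add_distrib, Pi.single_apply, ite_smul]

theorem mem_box_succ {B : Finset G} {n : ℕ} {b : G} (hb : b ∈ B) : b ∈ box B (n + 1) := by
  simpa using add_mem_box_succ hb (zero_mem_box B n)

variable {S : AddSubmonoid G}

/-- The pairs whose two entries and whose difference lie in `box B n`. The difference is bounded
separately because a product of words shifts entries by it: the bound that follows from those on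
the entries would at best double the box with every factor. -/
def wordBox (S : AddSubmonoid G) (B : Finset G) (n : ℕ) : Set (S × S) :=
  {p | (p.1 : G) ∈ box B n ∧ (p.2 : G) ∈ box B n ∧ (p.2 - p.1 : G) ∈ box B n}

theorem card_le_of_subset_wordBox {B : Finset G} {n : ℕ} {F : Finset (S × S)}
    (hF : ↑F ⊆ wordBox S B n) : F.card ≤ (n + 1) ^ (2 * B.card) := by
  have h : F.card ≤ (box B n ×ˢ box B n).card := by
    refine Finset.card_le_card_of_injOn (fun p => ((p.1 : G), (p.2 : G))) ?_ ?_
    · intro p hp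
      exact Finset.mk_mem_product (hF hp).1 (hF hp).2.1
    · intro p _ q _ hpq
      simp only [Prod.mk.injEq] at hpq
      exact Prod.ext (Subtype.ext hpq.1) (Subtype.ext hpq.2)
  rw [Finset.card_product, ← sq] at h
  calc F.card ≤ (box B n).card ^ 2 := h
    _ ≤ ((n + 1) ^ B.card) ^ 2 := Nat.pow_le_pow_left (card_box_le B n) 2
    _ = (n + 1) ^ (2 * B.card) := by rw [← pow_mul, mul_comm]

open scoped Pointwise in
/-- Each entry and the degree of the product of a fixed word and another one are sums of at most
one entry or degree of either word, up to sign, so that the `n`-th power of a combination of words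
only involves a box of size `n`. -/
theorem exists_pow_mem_span_wordBox {A : Type*} [Ring A] [StarRing A] [Algebra ℂ A] {T : S → A}
    (hS : IsTotal S) (hadd : ∀ a b, T (a + b) = T a * T b)
    (hiso : ∀ a, star (T a) * T a = 1) {y : A} (hy : y ∈ Submodule.span ℂ (Set.range (word T))) :
    ∃ B : Finset G, ∀ n, y ^ n ∈ Submodule.span ℂ (word T '' wordBox S B n) := by
  classical
  obtain ⟨c, rfl⟩ := Finsupp.mem_span_range_iff_exists_finsupp.1 hy
  set F := c.support
  have hy : (c.sum fun p x => x • word T p) ∈ Submodule.span ℂ (word T '' F) :=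
    Submodule.sum_mem _ fun p hp =>
      Submodule.smul_mem _ _ (Submodule.subset_span ⟨p, hp, rfl⟩)
  set B : Finset G := F.image (fun p => (p.1 : G)) ∪ F.image (fun p => (p.2 : G)) ∪
    F.image (fun p => (p.1 - p.2 : G)) ∪ F.image (fun p => (p.2 - p.1 : G)) with hB
  have hBmem : ∀ p ∈ F, (p.1 : G) ∈ B ∧ (p.2 : G) ∈ B ∧ (p.1 - p.2 : G) ∈ B ∧
      (p.2 - p.1 : G) ∈ B := by
    intro p hp
    simp only [hB, Finset.mem_union, Finset.mem_image]
    exact ⟨Or.inl (Or.inl (Or.inl ⟨p, hp, rfl⟩)), Or.inl (Or.inl (Or.inr ⟨p, hp, rfl⟩)),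
      Or.inl (Or.inr ⟨p, hp, rfl⟩), Or.inr ⟨p, hp, rfl⟩⟩
  refine ⟨B, fun n => ?_⟩
  induction n with
  | zero =>
    have hone := map_zero_eq_one hadd hiso
    rw [pow_zero]
    refine Submodule.subset_span ⟨(0, 0), ⟨?_, ?_, ?_⟩, by simp [word, hone]⟩ <;>
      simp [zero_mem_box]
  | succ n ih =>
    rw [pow_succ']
    have h := Submodule.mul_mem_mul hy ih
    rw [Submodule.span_mul_span] at h
    refine Submodule.span_mono ?_ h
    rintro _ ⟨_, ⟨p, hp, rfl⟩, _, ⟨q, ⟨hq1, hq2, hq3⟩, rfl⟩, rfl⟩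
    obtain ⟨r, hr, hr'⟩ := exists_word_mul hS hadd hiso p q
    obtain ⟨hp1, hp2, hp3, hp4⟩ := hBmem p hp
    have hsucc := box_mono B n.le_succ
    refine ⟨r, ?_, hr.symm⟩
    rcases hr' with ⟨h1, h2⟩ | ⟨h1, h2⟩
    · refine ⟨h1 ▸ add_mem_box_succ hp3 hq1, h2 ▸ hsucc hq2, ?_⟩
      have e : (r.2 - r.1 : G) = (p.2 - p.1) + (q.2 - q.1) := by rw [h1, h2]; abel
      exact e ▸ add_mem_box_succ hp4 hq3
    · refine ⟨h1 ▸ mem_box_succ hp1, h2 ▸ add_mem_box_succ hp2 hq3, ?_⟩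
      have e : (r.2 - r.1 : G) = (p.2 - p.1) + (q.2 - q.1) := by rw [h1, h2]; abel
      exact e ▸ add_mem_box_succ hp4 hq3

end Growth

/-! ### Uniqueness of the norm -/

section Norm

theorem le_of_pow_two_pow_le {s t C : ℝ} {m : ℕ} (hs : 0 ≤ s) (ht : 0 ≤ t)
    (h : ∀ k : ℕ, t ^ 2 ^ k ≤ C * (2 ^ k + 1 : ℝ) ^ m * s ^ 2 ^ k) : t ≤ s := by
  by_contra! hst
  have ht0 : 0 < t := hs.trans_lt hst
  have hr : |s / t| < 1 := by
    rw [abs_of_nonneg (div_nonneg hs ht)]; exact (div_lt_one ht0).2 hst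
  have hlim := ((tendsto_pow_const_mul_const_pow_of_abs_lt_one m hr).comp
    (tendsto_pow_atTop_atTop_of_one_lt (one_lt_two (α := ℕ)))).const_mul (|C| * 2 ^ m)
  rw [mul_zero] at hlim
  obtain ⟨k, hk⟩ := (hlim.eventually (gt_mem_nhds one_pos)).exists
  refine absurd hk (not_lt.2 ?_)
  have h2 : (1 : ℝ) ≤ 2 ^ k := one_le_pow₀ one_le_two
  have hle : (2 ^ k + 1 : ℝ) ^ m ≤ 2 ^ m * (2 ^ k) ^ m := by
    rw [← mul_pow]; exact pow_le_pow_left₀ (by positivity) (by linarith) m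
  have hpos : 0 < t ^ 2 ^ k := pow_pos ht0 _
  have h1 : 1 ≤ C * (2 ^ k + 1 : ℝ) ^ m * (s / t) ^ 2 ^ k := by
    rw [div_pow, ← mul_div_assoc, le_div_iff₀ hpos, one_mul]
    exact h k
  calc (1 : ℝ) ≤ C * (2 ^ k + 1 : ℝ) ^ m * (s / t) ^ 2 ^ k := h1
    _ ≤ |C| * (2 ^ m * (2 ^ k) ^ m) * (s / t) ^ 2 ^ k := by
      gcongr
      exact le_abs_self C
    _ = |C| * 2 ^ m * (((2 ^ k : ℕ) : ℝ) ^ m * (s / t) ^ 2 ^ k) := by push_cast; ring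

variable {G : Type*} [AddCommGroup G] {S : AddSubmonoid G}
variable {A : Type*} [CStarAlgebra A] {T : S → A}

theorem norm_word_le (hiso : ∀ a, star (T a) * T a = 1) (p : S × S) :
    ‖word T p‖ ≤ ‖(1 : A)‖ := by
  have h : ∀ a, ‖T a‖ * ‖T a‖ = ‖(1 : A)‖ := fun a => by
    rw [← CStarRing.norm_star_mul_self, hiso]
  have heq : ‖T p.1‖ = ‖T p.2‖ :=
    (mul_self_inj (norm_nonneg _) (norm_nonneg _)).1 ((h _).trans (h _).symm)
  calc ‖word T p‖ ≤ ‖T p.1‖ * ‖star (T p.2)‖ := norm_mul_le _ _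
    _ = ‖(1 : A)‖ := by rw [norm_star, heq, h]

theorem mem_span_word_of_mem_adjoin (hS : IsTotal S) (hadd : ∀ a b, T (a + b) = T a * T b)
    (hiso : ∀ a, star (T a) * T a = 1) {x : A} (hx : x ∈ StarAlgebra.adjoin ℂ (Set.range T)) :
    x ∈ Submodule.span ℂ (Set.range (word T)) := by
  have hone := map_zero_eq_one hadd hiso
  induction hx using StarAlgebra.adjoin_induction with
  | mem x hx =>
    obtain ⟨a, rfl⟩ := hx
    exact Submodule.subset_span ⟨(a, 0), by simp [word, hone]⟩
  | algebraMap r =>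
    rw [Algebra.algebraMap_eq_smul_one]
    exact Submodule.smul_mem _ _ (Submodule.subset_span ⟨(0, 0), by simp [word, hone]⟩)
  | add x y _ _ hx hy => exact add_mem hx hy
  | mul x y _ _ hx hy =>
    have h := Submodule.mul_mem_mul hx hy
    rw [Submodule.span_mul_span] at h
    refine Submodule.span_mono ?_ h
    rintro _ ⟨_, ⟨p, rfl⟩, _, ⟨q, rfl⟩, rfl⟩
    obtain ⟨r, hr, -⟩ := exists_word_mul hS hadd hiso p q
    exact ⟨r, hr.symm⟩
  | star x _ hx =>
    clear * - hx
    induction hx using Submodule.span_induction with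
    | mem x hx =>
      obtain ⟨p, rfl⟩ := hx
      exact Submodule.subset_span ⟨p.swap, (star_word T p).symm⟩
    | zero => simp
    | add x y _ _ hx hy => rw [star_add]; exact add_mem hx hy
    | smul c x _ hx => rw [star_smul]; exact Submodule.smul_mem _ _ hx

variable {H : Type*} [NormedAddCommGroup H] [InnerProductSpace ℂ H] [CompleteSpace H]

/-- For totally ordered `S`, a representation in `Δ_S` through which a family of isometries
factors is isometric on the algebra generated by the family: for `y = x* x` the power `y ^ n`
is a combination of polynomially many words with coefficients at most `2 * ‖π y‖ ^ n`, so that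
`‖y‖ ^ n` is at most a polynomial in `n` times `‖π y‖ ^ n`. -/
theorem norm_le_norm_map_of_mem_adjoin (hS : IsTotal S) (hS' : ContainsNoGroups S)
    (hadd : ∀ a b, T (a + b) = T a * T b) (hiso : ∀ a, star (T a) * T a = 1)
    (π : A →⋆ₐ[ℂ] (H →L[ℂ] H)) (hπ : IsDeltaRep fun a => π (T a)) {x : A}
    (hx : x ∈ StarAlgebra.adjoin ℂ (Set.range T)) : ‖x‖ ≤ ‖π x‖ := by
  have hword : ∀ p, π (word T p) = word (fun a => π (T a)) p := fun p => by
    simp [word, map_star]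
  set y := star x * x
  have hy : y ∈ Submodule.span ℂ (Set.range (word T)) :=
    mem_span_word_of_mem_adjoin hS hadd hiso (mul_mem (star_mem hx) hx)
  obtain ⟨B, hB⟩ := exists_pow_mem_span_wordBox hS hadd hiso hy
  have key : ∀ n : ℕ, ‖y ^ n‖ ≤ 2 * ‖(1 : A)‖ * (n + 1 : ℝ) ^ (2 * B.card) * ‖π y‖ ^ n := by
    intro n
    obtain ⟨c, hc, hcy⟩ := (Finsupp.mem_span_image_iff_linearCombination ℂ).1 (hB n)
    have hcard := card_le_of_subset_wordBox ((Finsupp.mem_supported ℂ c).1 hc)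
    rw [Finsupp.linearCombination_apply, Finsupp.sum] at hcy
    have hcoeff : ∀ p ∈ c.support, ‖c p‖ ≤ 2 * ‖π y‖ ^ n := by
      intro p hp
      have h := norm_coeff_le hS hS' hπ c.support c hp
      have e : ∑ p ∈ c.support, c p • word (fun a => π (T a)) p = π y ^ n := by
        rw [← map_pow, ← hcy, map_sum]
        exact Finset.sum_congr rfl fun p _ => by rw [map_smul, hword]
      rw [e] at h
      refine h.trans (mul_le_mul_of_nonneg_left ?_ zero_le_two)
      rcases n.eq_zero_or_pos with rfl | hn
      · rw [pow_zero, pow_zero]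
        exact ContinuousLinearMap.norm_id_le
      · exact norm_pow_le' _ hn
    calc ‖y ^ n‖ = ‖∑ p ∈ c.support, c p • word T p‖ := by rw [hcy]
      _ ≤ ∑ p ∈ c.support, ‖c p • word T p‖ := norm_sum_le _ _
      _ ≤ ∑ p ∈ c.support, 2 * ‖π y‖ ^ n * ‖(1 : A)‖ := by
        refine Finset.sum_le_sum fun p hp => (norm_smul_le _ _).trans ?_
        exact mul_le_mul (hcoeff p hp) (norm_word_le hiso p) (norm_nonneg _) (by positivity)
      _ = c.support.card * (2 * ‖π y‖ ^ n * ‖(1 : A)‖) := by rw [Finset.sum_const, nsmul_eq_mul]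
      _ ≤ (n + 1 : ℝ) ^ (2 * B.card) * (2 * ‖π y‖ ^ n * ‖(1 : A)‖) := by
        gcongr
        exact_mod_cast hcard
      _ = 2 * ‖(1 : A)‖ * (n + 1 : ℝ) ^ (2 * B.card) * ‖π y‖ ^ n := by ring
  have hyle : ‖y‖ ≤ ‖π y‖ := by
    refine le_of_pow_two_pow_le (C := 2 * ‖(1 : A)‖) (m := 2 * B.card) (norm_nonneg _)
      (norm_nonneg _) fun k => ?_
    rw [← (IsSelfAdjoint.star_mul_self x).norm_pow_two_pow]
    simpa using key (2 ^ k)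
  have h1 : ‖y‖ = ‖x‖ * ‖x‖ := CStarRing.norm_star_mul_self
  have h2 : ‖π y‖ = ‖π x‖ * ‖π x‖ := by
    rw [map_mul, map_star, CStarRing.norm_star_mul_self]
  rw [h1, h2] at hyle
  exact (mul_self_le_mul_self_iff (norm_nonneg _) (norm_nonneg _)).2 hyle

end Norm

/-! ### Canonical isomorphisms -/

section Isomorphism

variable {A B : Type*} [CStarAlgebra A] [CStarAlgebra B]

/-- A star homomorphism that does not decrease the norm on a generated star algebra is isometric
on its closure, so that its image there is closed and hence the whole generated C*-algebra. -/
theorem exists_starAlgEquiv_closure_adjoin (π : A →⋆ₐ[ℂ] B) {s : Set A} {t : Set B}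
    (hst : π '' s = t) (hπ : ∀ x ∈ StarAlgebra.adjoin ℂ s, ‖x‖ ≤ ‖π x‖) :
    ∃ e : (StarAlgebra.adjoin ℂ s).topologicalClosure ≃⋆ₐ[ℂ]
      (StarAlgebra.adjoin ℂ t).topologicalClosure, ∀ x, (e x : B) = π x := by
  subst hst
  have hcont : Continuous π := (AddMonoidHomClass.continuous_of_bound π 1 fun x => by
    simpa using NonUnitalStarAlgHom.norm_apply_le π x)
  have hnorm : ∀ x ∈ (StarAlgebra.adjoin ℂ s).topologicalClosure, ‖x‖ ≤ ‖π x‖ := by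
    intro x hx
    refine closure_minimal (s := (StarAlgebra.adjoin ℂ s : Set A)) (t := {x | ‖x‖ ≤ ‖π x‖})
      hπ (isClosed_le continuous_norm hcont.norm) hx
  have hmaps : ∀ x : (StarAlgebra.adjoin ℂ s).topologicalClosure,
      π x ∈ (StarAlgebra.adjoin ℂ (π '' s)).topologicalClosure := by
    intro x
    rw [← StarAlgHom.map_adjoin]
    exact map_mem_closure hcont x.2 fun y hy => ⟨y, hy, rfl⟩
  let f : (StarAlgebra.adjoin ℂ s).topologicalClosure →⋆ₐ[ℂ]
      (StarAlgebra.adjoin ℂ (π '' s)).topologicalClosure :=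
    (π.comp (StarSubalgebra.subtype _)).codRestrict _ hmaps
  have hf : ∀ x, (f x : B) = π x := fun _ => rfl
  have hbij : Function.Bijective f := by
    constructor
    · refine (injective_iff_map_eq_zero f).2 fun x hx => Subtype.ext (norm_le_zero_iff.1 ?_)
      have h0 : π x = 0 := by rw [← hf, hx]; rfl
      simpa [h0] using hnorm x x.2
    · set C := (StarAlgebra.adjoin ℂ s).topologicalClosure
      have : CompleteSpace C := (StarSubalgebra.isClosed_topologicalClosure _).completeSpace_coe
      have hisom : Isometry (π.comp C.subtype) :=
        AddMonoidHomClass.isometry_of_norm _ fun x =>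
          le_antisymm (NonUnitalStarAlgHom.norm_apply_le π (x : A)) (hnorm x x.2)
      have hle : (StarAlgebra.adjoin ℂ (π '' s)).topologicalClosure ≤ (π.comp C.subtype).range := by
        refine StarSubalgebra.topologicalClosure_minimal (StarAlgebra.adjoin_le ?_) ?_
        · rintro _ ⟨x, hx, rfl⟩
          exact ⟨⟨x, StarSubalgebra.le_topologicalClosure _ (StarAlgebra.subset_adjoin ℂ s hx)⟩,
            rfl⟩
        · change IsClosed (Set.range (π.comp C.subtype))
          exact hisom.isClosedEmbedding.isClosed_range
      rintro ⟨y, hy⟩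
      obtain ⟨x, hx⟩ := hle hy
      exact ⟨x, Subtype.ext hx⟩
  exact ⟨StarAlgEquiv.ofBijective f hbij, fun x => hf x⟩

end Isomorphism

/-! ### Comparison of the four conditions -/

section Equivalence

variable {G : Type*} [AddCommGroup G] {S : AddSubmonoid G}

theorem isPositiveConeOf_iff_isTotal (hS : ContainsNoGroups S) :
    IsPositiveConeOf S (differenceGroup S) ↔ IsTotal S := by
  constructor
  · rintro ⟨h, -⟩ a b
    simpa using (h (a - b)).1 ⟨a, a.2, b, b.2, rfl⟩
  · refine fun h => ⟨fun g => ⟨?_, ?_⟩, fun g => ⟨fun hg => hS.eq_zero hg.1 hg.2, ?_⟩⟩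
    · rintro ⟨a, ha, b, hb, rfl⟩
      simpa using h ⟨a, ha⟩ ⟨b, hb⟩
    · rintro (hg | hg)
      · exact ⟨g, hg, 0, S.zero_mem, by simp⟩
      · exact ⟨0, S.zero_mem, -g, hg, by simp⟩
    · rintro rfl
      simp

variable {H : Type*} [NormedAddCommGroup H] [InnerProductSpace ℂ H] [CompleteSpace H]
variable {H' : Type*} [NormedAddCommGroup H'] [InnerProductSpace ℂ H'] [CompleteSpace H']
variable {V : S → H →L[ℂ] H} {W : S → H' →L[ℂ] H'}

/-- Both C*-algebras are canonically isomorphic to the one generated by the pairs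
`(V a, W a)` in `B(H) × B(H')`. -/
theorem canonicallyIsomorphic_of_isTotal (hS : IsTotal S) (hS' : ContainsNoGroups S)
    (hV : IsDeltaRep V) (hW : IsDeltaRep W) : CanonicallyIsomorphic V W := by
  let T : S → (H →L[ℂ] H) × (H' →L[ℂ] H') := fun a => (V a, W a)
  have hadd : ∀ a b, T (a + b) = T a * T b := fun a b =>
    Prod.ext (hV.isometric.map_add a b) (hW.isometric.map_add a b)
  have hiso : ∀ a, star (T a) * T a = 1 := fun a =>
    Prod.ext (hV.isometric.star_mul_self a) (hW.isometric.star_mul_self a)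
  let C := (StarAlgebra.adjoin ℂ (Set.range T)).topologicalClosure
  obtain ⟨e₁, he₁⟩ : ∃ e : C ≃⋆ₐ[ℂ] cstarAlg V, ∀ x : C, (e x : H →L[ℂ] H) = x.1.1 :=
    exists_starAlgEquiv_closure_adjoin
    (StarAlgHom.fst ℂ (H →L[ℂ] H) (H' →L[ℂ] H')) (s := Set.range T) (t := Set.range V)
    (by rw [← Set.range_comp]; rfl)
    fun x hx => norm_le_norm_map_of_mem_adjoin hS hS' hadd hiso _ hV hx
  obtain ⟨e₂, he₂⟩ : ∃ e : C ≃⋆ₐ[ℂ] cstarAlg W, ∀ x : C, (e x : H' →L[ℂ] H') = x.1.2 :=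
    exists_starAlgEquiv_closure_adjoin
    (StarAlgHom.snd ℂ (H →L[ℂ] H) (H' →L[ℂ] H')) (s := Set.range T) (t := Set.range W)
    (by rw [← Set.range_comp]; rfl)
    fun x hx => norm_le_norm_map_of_mem_adjoin hS hS' hadd hiso _ hW hx
  refine ⟨e₁.symm.trans e₂, fun a => ?_⟩
  let g : C :=
    ⟨T a, StarSubalgebra.le_topologicalClosure _
      (StarAlgebra.subset_adjoin ℂ (Set.range T) (Set.mem_range_self a))⟩
  have h₁ : e₁ g = gen V a := Subtype.ext (he₁ g)
  have h₂ : e₂ g = gen W a := Subtype.ext (he₂ g)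
  calc e₂ (e₁.symm (gen V a)) = e₂ (e₁.symm (e₁ g)) := by rw [h₁]
    _ = gen W a := by rw [StarAlgEquiv.symm_apply_apply, h₂]

theorem CanonicallyIsomorphic.range_proj_comm (h : CanonicallyIsomorphic V W) {a b : S}
    (hV : V a * star (V a) * V b * star (V b) = V b * star (V b) * V a * star (V a)) :
    W a * star (W a) * W b * star (W b) = W b * star (W b) * W a * star (W a) := by
  obtain ⟨φ, hφ⟩ := h
  have hgen : gen V a * star (gen V a) * gen V b * star (gen V b) =
      gen V b * star (gen V b) * gen V a * star (gen V a) := Subtype.ext hV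
  have := congrArg φ hgen
  simp only [map_mul, map_star, hφ] at this
  exact congrArg Subtype.val this

end Equivalence

end IsomRep

end

theorem mainTheorem1 {G : Type u} [AddCommGroup G] [IsAddTorsionFree G]
    (S : AddSubmonoid G) (hS : IsomRep.ContainsNoGroups S) :
    List.TFAE [
      -- (1) `S` is a positive cone, of the group that it generates
      IsomRep.IsPositiveConeOf S (IsomRep.differenceGroup S),
      -- (2) all representations generate canonically isomorphic C*-algebras
      ∀ (H : Type u) [NormedAddCommGroup H] [InnerProductSpace ℂ H] [CompleteSpace H]
        (H' : Type u) [NormedAddCommGroup H'] [InnerProductSpace ℂ H'] [CompleteSpace H']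
        (V : S → H →L[ℂ] H) (W : S → H' →L[ℂ] H'),
        IsomRep.IsDeltaRep V → IsomRep.IsDeltaRep W → IsomRep.CanonicallyIsomorphic V W,
      -- (3) all representations are inverse
      ∀ (H : Type u) [NormedAddCommGroup H] [InnerProductSpace ℂ H] [CompleteSpace H]
        (V : S → H →L[ℂ] H),
        IsomRep.IsDeltaRep V → IsomRep.IsInverseRep V,
      -- (4) in every representation the range projections commute
      ∀ (H : Type u) [NormedAddCommGroup H] [InnerProductSpace ℂ H] [CompleteSpace H]
        (V : S → H →L[ℂ] H), IsomRep.IsDeltaRep V →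
        ∀ a b : S, V a * star (V a) * V b * star (V b) = V b * star (V b) * V a * star (V a)] := by
  tfae_have 1 → 2 := by
    intro h H _ _ _ H' _ _ _ V W hV hW
    exact IsomRep.canonicallyIsomorphic_of_isTotal
      ((IsomRep.isPositiveConeOf_iff_isTotal hS).1 h) hS hV hW
  tfae_have 2 → 4 := by
    intro h H _ _ _ V hV a b
    exact (h _ _ _ V (IsomRep.isDeltaRep_regularRep hS) hV).range_proj_comm
      (IsomRep.regularRep_comm a b)
  tfae_have 1 → 3 := by
    intro h H _ _ _ V hV
    exact IsomRep.isInverseRep_of_isTotal ((IsomRep.isPositiveConeOf_iff_isTotal hS).1 h) hV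
  tfae_have 3 → 4 := by
    intro h H _ _ _ V hV a b
    exact (h H V hV).range_proj_comm hV.isometric a b
  tfae_have 4 → 1 := by
    intro h
    rw [IsomRep.isPositiveConeOf_iff_isTotal hS]
    intro a b
    by_contra! hab
    -- as `G` has no torsion, `2(a - b)` and `2(b - a)` cannot both lie in `S`
    by_cases h2 : (b - a + (b - a) : G) ∈ S
    · have h2' : (a - b + (a - b) : G) ∉ S := by
        intro h2'
        have h0 := hS.eq_zero h2 (by convert h2' using 1; abel)
        rw [← two_nsmul, nsmul_eq_zero_iff_right two_ne_zero] at h0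
        exact hab.2 (h0 ▸ S.zero_mem)
      obtain ⟨η, hη, hne⟩ := IsomRep.exists_isDeltaRep_not_comm hS hab.2 hab.1 h2'
      exact hne (h _ _ hη b a)
    · obtain ⟨η, hη, hne⟩ := IsomRep.exists_isDeltaRep_not_comm hS hab.1 hab.2 h2
      exact hne (h _ _ hη a b)
  tfae_finish
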